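/- Let $d\ge 2$, $\eta>0$, and let $u_1^{(1)},\ldots,u_n^{(1)}\in S^{d-1}\subset\mathbb{R}^d$ be arbitrary (deterministic) unit vectors, the initial opinions. Let $v^{(1)},v^{(2)},\ldots$ be independent random vectors, each uniformly distributed on the unit sphere $S^{d-1}$, and for $t\ge 1$ and $1\le i\le n$ define \[ u_i^{(t+1)}=\frac{w_i^{(t+1)}}{\|w_i^{(t+1)}\|},\qquad w_i^{(t+1)}=u_i^{(t)}+\eta\,\langle u_i^{(t)},v^{(t)}\rangle\, v^{(t)}, \] where $\|\cdot\|$ is the Euclidean norm. Then for all $1\le i<j\le n$, \[ \Pr\Big[\lim_{t\to\infty}\|u_i^{(t)}-u_j^{(t)}\|=0\ \text{ or }\ \lim_{t\to\infty}\|u_i^{(t)}+u_j^{(t)}\|=0\Big]=1 . \] -/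

import Mathlib

open MeasureTheory ProbabilityTheory Filter Topology

/-- The uniform probability measure on the unit sphere `S^{d-1}` of `ℝ^d`: the surface measure
induced by Lebesgue measure, divided by its total mass. -/
noncomputable def uniformSphere (d : ℕ) :
    Measure (Metric.sphere (0 : EuclideanSpace ℝ (Fin d)) 1) :=
  ((volume : Measure (EuclideanSpace ℝ (Fin d))).toSphere Set.univ)⁻¹ •
    (volume : Measure (EuclideanSpace ℝ (Fin d))).toSphere

/-- The unnormalized result `w = u + η ⟨u, v⟩ v` of applying the intervention `v` to the
opinion `u`. -/
noncomputable def shiftedOpinion {d : ℕ} (η : ℝ) (u v : EuclideanSpace ℝ (Fin d)) :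
    EuclideanSpace ℝ (Fin d) :=
  u + (η * inner ℝ u v) • v

/-- The updated opinion `w / ‖w‖` after applying the intervention `v` to the opinion `u`.
For unit vectors `u`, `v` and `η > 0` one has `‖w‖ ≥ 1`, so this is again a unit vector. -/
noncomputable def updateOpinion {d : ℕ} (η : ℝ) (u v : EuclideanSpace ℝ (Fin d)) :
    EuclideanSpace ℝ (Fin d) :=
  ‖shiftedOpinion η u v‖⁻¹ • shiftedOpinion η u v

/-- The opinion obtained from the initial opinion `u` after applying the first `t`
interventions `v 0, …, v (t - 1)`. -/
noncomputable def opinion {d : ℕ} (η : ℝ) (u : EuclideanSpace ℝ (Fin d))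
    (v : ℕ → EuclideanSpace ℝ (Fin d)) : ℕ → EuclideanSpace ℝ (Fin d)
  | 0 => u
  | t + 1 => updateOpinion η (opinion η u v t) (v t)

/-! The squared sine of the angle between two opinions is a Gram determinant. An update along `v`
multiplies it by `(1 + c(α² + α'²)) / ((1 + cα²)(1 + cγ²))`, where `c = 2η + η²`, `α` and `γ` are
the components of `v` along `u` and `w`, and `α'` is its component along the unit vector completing
`u` to an orthonormal basis of the plane of `u` and `w`. The logarithm of this factor is the average
of two values of `logGain`, one for `u` and one for `w`, each taken at an orthonormal pair.

Rotation invariance makes the mean of `logGain` the same for every orthonormal pair. It is negative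
because the two orderings of a pair sum to twice `log(1 + c(x + y)) - log((1 + cx)(1 + cy)) ≤ 0`,
strictly on an open set meeting the sphere (`integral_logGain_neg`). Since `logGain` is bounded,
some small exponential moment is then below one (`exists_integral_exp_logGain_le`), so one update
contracts the expected `p`-th power of the squared sine by a fixed factor, whatever the current
pair.

Iterating with independence, these expectations decay geometrically, so their sum is finite and the
squared sine tends to zero almost surely. Near parallelism the sign of the inner product can no
longer change, so one of the two alternatives holds. -/

/-! ### Rotation invariance of the uniform measure on the sphere -/

section Sphere

variable {E : Type*} [NormedAddCommGroup E] [InnerProductSpace ℝ E]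

/-- Any orthonormal pair is carried to any other one by a linear isometry. -/
theorem exists_linearIsometryEquiv_map_pair {a b a' b' : E} (ha : ‖a‖ = 1) (hb : ‖b‖ = 1)
    (hab : inner ℝ a b = 0) (ha' : ‖a'‖ = 1) (hb' : ‖b'‖ = 1) (hab' : inner ℝ a' b' = 0) :
    ∃ g : E ≃ₗᵢ[ℝ] E, g a = a' ∧ g b = b' := by
  set R := (ℝ ∙ (a - a'))ᗮ.reflection
  have hRa : R a = a' := Submodule.reflection_sub (ha.trans ha'.symm)
  have hRb : ‖R b‖ = ‖b'‖ := by rw [R.norm_map, hb, hb']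
  -- The second reflection sends `R b` to `b'` and fixes `a'`, since `a' = R a` is orthogonal to
  -- both `R b` and `b'`.
  refine ⟨R.trans (ℝ ∙ (R b - b'))ᗮ.reflection, ?_, ?_⟩
  · rw [LinearIsometryEquiv.trans_apply, hRa]
    apply Submodule.reflection_mem_subspace_eq_self
    rw [Submodule.mem_orthogonal_singleton_iff_inner_left, inner_sub_right, hab', ← hRa,
      R.inner_map_map, hab, sub_zero]
  · rw [LinearIsometryEquiv.trans_apply]
    exact Submodule.reflection_sub hRb

open scoped Pointwise in
-- Surface measure is a multiple of the volume of the cone `(0,1) • s`; an isometry carries cones to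
-- cones and preserves volume.
theorem map_toSphere_linearIsometryEquiv [FiniteDimensional ℝ E] [MeasurableSpace E] [BorelSpace E]
    (g : E ≃ₗᵢ[ℝ] E) :
    ((volume : Measure E).toSphere.map (↑)).map g =
      ((volume : Measure E).toSphere.map ((↑) : Metric.sphere (0 : E) 1 → E)) := by
  ext s hs
  have hg : Measurable g := g.continuous.measurable
  rw [Measure.map_apply hg hs, Measure.map_apply measurable_subtype_coe (hg hs),
    Measure.map_apply measurable_subtype_coe hs,
    Measure.toSphere_apply' _ (measurable_subtype_coe (hg hs)),
    Measure.toSphere_apply' _ (measurable_subtype_coe hs)]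
  congr 1
  rw [← g.measurePreserving.measure_preimage_emb g.toHomeomorph.measurableEmbedding
    (Set.Ioo (0 : ℝ) 1 • (Subtype.val '' (Subtype.val ⁻¹' s : Set (Metric.sphere (0 : E) 1))))]
  congr 1
  ext x
  simp only [Set.mem_smul, Set.mem_image, Set.mem_preimage, Subtype.exists, mem_sphere_zero_iff_norm,
    exists_and_left, exists_prop]
  constructor
  · rintro ⟨r, hr, _, ⟨y, hy, hn, rfl⟩, rfl⟩
    exact ⟨r, hr, g y, ⟨g y, hy, by rw [g.norm_map, hn], rfl⟩, by simp⟩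
  · rintro ⟨r, hr, _, ⟨y, hy, hn, rfl⟩, h⟩
    refine ⟨r, hr, g.symm y, ⟨g.symm y, by simpa using hy, by rw [g.symm.norm_map, hn], rfl⟩, ?_⟩
    apply g.injective
    rw [← h]
    simp

end Sphere

/-- The uniform probability measure on the unit sphere, as a measure on the ambient space. -/
noncomputable def uniformSphereAmbient (d : ℕ) : Measure (EuclideanSpace ℝ (Fin d)) :=
  (uniformSphere d).map (↑)

theorem map_uniformSphereAmbient {d : ℕ}
    (g : EuclideanSpace ℝ (Fin d) ≃ₗᵢ[ℝ] EuclideanSpace ℝ (Fin d)) :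
    (uniformSphereAmbient d).map g = uniformSphereAmbient d := by
  rw [uniformSphereAmbient, uniformSphere, Measure.map_smul, Measure.map_smul,
    map_toSphere_linearIsometryEquiv]

theorem ae_norm_eq_one_uniformSphereAmbient (d : ℕ) :
    ∀ᵐ v ∂uniformSphereAmbient d, ‖v‖ = 1 := by
  rw [uniformSphereAmbient, ae_map_iff measurable_subtype_coe.aemeasurable
    (measurableSet_eq_fun measurable_norm measurable_const)]
  exact ae_of_all _ fun x => norm_eq_of_mem_sphere x

theorem integral_comp_linearIsometryEquiv_uniformSphereAmbient {d : ℕ}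
    (g : EuclideanSpace ℝ (Fin d) ≃ₗᵢ[ℝ] EuclideanSpace ℝ (Fin d))
    (f : EuclideanSpace ℝ (Fin d) → ℝ) :
    ∫ v, f (g v) ∂uniformSphereAmbient d = ∫ v, f v ∂uniformSphereAmbient d :=
  MeasurePreserving.integral_comp ⟨g.continuous.measurable, map_uniformSphereAmbient g⟩
    g.toHomeomorph.measurableEmbedding f

/-- An open set meeting the unit sphere has positive measure. -/
theorem uniformSphereAmbient_ne_zero {d : ℕ} {U : Set (EuclideanSpace ℝ (Fin d))} (hU : IsOpen U)
    {x : EuclideanSpace ℝ (Fin d)} (hx : ‖x‖ = 1) (hxU : x ∈ U) :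
    uniformSphereAmbient d U ≠ 0 := by
  rw [uniformSphereAmbient, Measure.map_apply measurable_subtype_coe hU.measurableSet, uniformSphere,
    Measure.smul_apply, smul_eq_mul]
  refine mul_ne_zero (ENNReal.inv_ne_zero.2 (measure_ne_top _ _)) ?_
  exact (hU.preimage continuous_subtype_val).measure_ne_zero _
    ⟨⟨x, mem_sphere_zero_iff_norm.2 hx⟩, hxU⟩

/-! ### Pointwise bounds on the logarithmic gain -/

section Drift

variable {E : Type*} [NormedAddCommGroup E] [InnerProductSpace ℝ E]

/-- The logarithmic growth of the area of a square spanned by orthonormal `a`, `b`, relative to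
the growth of `a`, up to a factor two, under a rank-one perturbation along `v`. -/
noncomputable def logGain (c : ℝ) (a b v : E) : ℝ :=
  Real.log (1 + c * (inner ℝ a v ^ 2 + inner ℝ b v ^ 2)) - 2 * Real.log (1 + c * inner ℝ a v ^ 2)

theorem logGain_map (c : ℝ) (a b v : E) (g : E ≃ₗᵢ[ℝ] E) :
    logGain c (g a) (g b) (g v) = logGain c a b v := by
  simp only [logGain, g.inner_map_map]

theorem sq_inner_le_one {a v : E} (ha : ‖a‖ = 1) (hv : ‖v‖ = 1) : inner ℝ a v ^ 2 ≤ 1 := by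
  have := abs_real_inner_le_norm a v
  rw [ha, hv, one_mul] at this
  exact (sq_le_one_iff_abs_le_one _).2 this

theorem abs_logGain_le {c : ℝ} (hc : 0 < c) {a b v : E} (ha : ‖a‖ = 1) (hb : ‖b‖ = 1)
    (hv : ‖v‖ = 1) : |logGain c a b v| ≤ 2 * Real.log (1 + 2 * c) := by
  have h1 := sq_inner_le_one ha hv
  have h2 := sq_inner_le_one hb hv
  have h3 := sq_nonneg (inner ℝ a v)
  have h4 := sq_nonneg (inner ℝ b v)
  have k (x : ℝ) (hx : 0 ≤ x) (hx' : x ≤ 2) :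
      0 ≤ Real.log (1 + c * x) ∧ Real.log (1 + c * x) ≤ Real.log (1 + 2 * c) := by
    refine ⟨Real.log_nonneg (by nlinarith), Real.log_le_log (by nlinarith) (by nlinarith)⟩
  have := k _ h3 (by linarith)
  have := k _ (add_nonneg h3 h4) (by linarith)
  rw [logGain, abs_le]
  constructor <;> linarith

theorem measurable_logGain [MeasurableSpace E] [BorelSpace E] (c : ℝ) (a b : E) :
    Measurable (logGain c a b) := by
  have h (x : E) : Measurable fun v : E => inner ℝ x v :=
    (continuous_const.inner continuous_id).measurable
  unfold logGain
  have := h a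
  have := h b
  fun_prop

/-- Expanding `(1 + cx)(1 + cy)` exceeds `1 + c(x + y)` by `c²xy ≥ 0`. -/
theorem logGain_add_swap_nonpos {c : ℝ} (hc : 0 < c) (a b v : E) :
    logGain c a b v + logGain c b a v ≤ 0 := by
  have h3 := sq_nonneg (inner ℝ a v)
  have h4 := sq_nonneg (inner ℝ b v)
  have ha : 0 < 1 + c * inner ℝ a v ^ 2 := by positivity
  have hb : 0 < 1 + c * inner ℝ b v ^ 2 := by positivity
  have := Real.log_le_log (x := 1 + c * (inner ℝ a v ^ 2 + inner ℝ b v ^ 2)) (by positivity)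
    (y := (1 + c * inner ℝ a v ^ 2) * (1 + c * inner ℝ b v ^ 2))
    (by nlinarith [mul_nonneg (mul_nonneg hc.le h3) (mul_nonneg hc.le h4)])
  rw [Real.log_mul ha.ne' hb.ne'] at this
  rw [logGain, logGain, add_comm (inner ℝ b v ^ 2)]
  linarith

theorem logGain_add_swap_neg {c : ℝ} (hc : 0 < c) {a b v : E} (ha : inner ℝ a v ≠ 0)
    (hb : inner ℝ b v ≠ 0) : logGain c a b v + logGain c b a v < 0 := by
  have h3 : 0 < inner ℝ a v ^ 2 := by positivity
  have h4 : 0 < inner ℝ b v ^ 2 := by positivity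
  have ha : 0 < 1 + c * inner ℝ a v ^ 2 := by positivity
  have hb : 0 < 1 + c * inner ℝ b v ^ 2 := by positivity
  have := Real.log_lt_log (x := 1 + c * (inner ℝ a v ^ 2 + inner ℝ b v ^ 2)) (by positivity)
    (y := (1 + c * inner ℝ a v ^ 2) * (1 + c * inner ℝ b v ^ 2))
    (by nlinarith [mul_pos (mul_pos hc h3) (mul_pos hc h4)])
  rw [Real.log_mul ha.ne' hb.ne'] at this
  rw [logGain, logGain, add_comm (inner ℝ b v ^ 2)]
  linarith

end Drift

/-! ### Negative mean and exponential moments of the gain -/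

section UniformDrift

variable {d : ℕ} {c : ℝ} {a b : EuclideanSpace ℝ (Fin d)}

theorem integrable_logGain [IsProbabilityMeasure (uniformSphereAmbient d)] (hc : 0 < c)
    (ha : ‖a‖ = 1) (hb : ‖b‖ = 1) : Integrable (logGain c a b) (uniformSphereAmbient d) :=
  Integrable.of_bound (measurable_logGain c a b).aestronglyMeasurable (2 * Real.log (1 + 2 * c))
    ((ae_norm_eq_one_uniformSphereAmbient d).mono fun _ hv => abs_logGain_le hc ha hb hv)

/-- An isometry exchanging `a` and `b` shows that both orderings have the same integral, so twice
that integral is the integral of the nonpositive symmetrized gain. -/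
theorem integral_logGain_neg [IsProbabilityMeasure (uniformSphereAmbient d)] (hc : 0 < c)
    (ha : ‖a‖ = 1) (hb : ‖b‖ = 1) (hab : inner ℝ a b = 0) :
    ∫ v, logGain c a b v ∂uniformSphereAmbient d < 0 := by
  have hba : inner ℝ b a = 0 := by rw [real_inner_comm, hab]
  obtain ⟨g, hga, hgb⟩ := exists_linearIsometryEquiv_map_pair ha hb hab hb ha hba
  have hswap : ∫ v, logGain c b a v ∂uniformSphereAmbient d =
      ∫ v, logGain c a b v ∂uniformSphereAmbient d := by
    rw [← integral_comp_linearIsometryEquiv_uniformSphereAmbient g]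
    congr 1 with v
    rw [← logGain_map c a b v g, hga, hgb]
  have hI1 := integrable_logGain (c := c) hc ha hb
  have hI2 := integrable_logGain (c := c) hc hb ha
  have hpos : 0 < ∫ v, -(logGain c a b v + logGain c b a v) ∂uniformSphereAmbient d := by
    rw [integral_pos_iff_support_of_nonneg
      (fun v => neg_nonneg.2 (logGain_add_swap_nonpos hc a b v)) (hI1.add hI2).neg]
    refine pos_iff_ne_zero.2 fun h0 => ?_
    have hopen : IsOpen {v : EuclideanSpace ℝ (Fin d) | inner ℝ a v ≠ 0 ∧ inner ℝ b v ≠ 0} :=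
      (isOpen_ne_fun (by fun_prop) (by fun_prop)).inter (isOpen_ne_fun (by fun_prop) (by fun_prop))
    have haa : inner ℝ a a = 1 := by rw [real_inner_self_eq_norm_sq, ha, one_pow]
    have hbb : inner ℝ b b = 1 := by rw [real_inner_self_eq_norm_sq, hb, one_pow]
    have hne : a + b ≠ 0 := fun h => by
      have : inner ℝ a (a + b) = 0 := by rw [h, inner_zero_right]
      rw [inner_add_right, haa, hab] at this
      norm_num at this
    -- The normalized sum of `a` and `b` is a point of the sphere where the symmetrized gain is
    -- strictly negative.
    refine uniformSphereAmbient_ne_zero hopen (x := ‖a + b‖⁻¹ • (a + b)) (norm_smul_inv_norm hne) ?_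
      (measure_mono_null ?_ h0)
    · have : ‖a + b‖ ≠ 0 := norm_ne_zero_iff.2 hne
      have ha0 : a ≠ 0 := norm_ne_zero_iff.1 (by rw [ha]; exact one_ne_zero)
      have hb0 : b ≠ 0 := norm_ne_zero_iff.1 (by rw [hb]; exact one_ne_zero)
      simp [inner_smul_right, inner_add_right, hab, hba, this, ha0, hb0]
    · exact fun v hv => neg_ne_zero.2 (logGain_add_swap_neg hc hv.1 hv.2).ne
  rw [integral_neg, integral_add hI1 hI2, hswap] at hpos
  linarith

/-- Some small exponential moment of `logGain` is bounded by a constant less than one, uniformly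
over all orthonormal pairs. -/
theorem exists_integral_exp_logGain_le [IsProbabilityMeasure (uniformSphereAmbient d)] (hd : 2 ≤ d)
    (hc : 0 < c) : ∃ p > 0, ∃ ρ < 1, ∀ a b : EuclideanSpace ℝ (Fin d), ‖a‖ = 1 → ‖b‖ = 1 →
      inner ℝ a b = 0 → ∫ v, Real.exp (p * logGain c a b v) ∂uniformSphereAmbient d ≤ ρ := by
  set e : EuclideanSpace ℝ (Fin d) := EuclideanSpace.single ⟨0, by omega⟩ 1
  set f : EuclideanSpace ℝ (Fin d) := EuclideanSpace.single ⟨1, by omega⟩ 1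
  have he : ‖e‖ = 1 := by simp [e]
  have hf : ‖f‖ = 1 := by simp [f]
  have hef : inner ℝ e f = 0 := by simp [e, f, EuclideanSpace.inner_single_left]
  set κ := -∫ v, logGain c e f v ∂uniformSphereAmbient d
  have hκ : 0 < κ := neg_pos.2 (integral_logGain_neg hc he hf hef)
  set K := 2 * Real.log (1 + 2 * c)
  have hK : 0 < K := mul_pos two_pos (Real.log_pos (by linarith))
  -- The bound `p ≤ 1 / K` keeps the exponent in `[-1, 1]`, where `exp x ≤ 1 + x + x²`; the bound `p
  -- ≤ κ / (2K²)` makes the quadratic term at most half of the linear gain `pκ`.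
  set p := min (1 / K) (κ / (2 * K ^ 2))
  have hp : 0 < p := lt_min (by positivity) (by positivity)
  have hp1 : p * K ≤ 1 := (le_div_iff₀ hK).1 (min_le_left _ _)
  have hp2 : p * (2 * K ^ 2) ≤ κ := (le_div_iff₀ (by positivity)).1 (min_le_right _ _)
  refine ⟨p, hp, 1 - p * κ + p ^ 2 * K ^ 2, by nlinarith [mul_pos hp hκ], fun a b ha hb hab => ?_⟩
  obtain ⟨g, hga, hgb⟩ := exists_linearIsometryEquiv_map_pair ha hb hab he hf hef
  have hint : ∫ v, logGain c a b v ∂uniformSphereAmbient d = -κ := by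
    rw [neg_neg, ← integral_comp_linearIsometryEquiv_uniformSphereAmbient g (logGain c e f)]
    congr 1 with v
    rw [← logGain_map c a b v g, hga, hgb]
  have hI := integrable_logGain (c := c) hc ha hb
  have hbd : ∀ᵐ v ∂uniformSphereAmbient d,
      Real.exp (p * logGain c a b v) ≤ (1 + p ^ 2 * K ^ 2) + p * logGain c a b v := by
    filter_upwards [ae_norm_eq_one_uniformSphereAmbient d] with v hv
    have h1 : |logGain c a b v| ≤ K := abs_logGain_le hc ha hb hv
    have h2 : |p * logGain c a b v| ≤ p * K := by
      rw [abs_mul, abs_of_pos hp]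
      exact mul_le_mul_of_nonneg_left h1 hp.le
    have h3 := (abs_le.1 (Real.abs_exp_sub_one_sub_id_le (h2.trans hp1))).2
    have h4 := sq_le_sq.2 (h2.trans (le_abs_self _))
    rw [mul_pow p K] at h4
    linarith
  calc _ ≤ ∫ v, ((1 + p ^ 2 * K ^ 2) + p * logGain c a b v) ∂uniformSphereAmbient d :=
        integral_mono_of_nonneg (ae_of_all _ fun v => (Real.exp_pos _).le)
          ((integrable_const _).add (hI.const_mul p)) hbd
    _ = 1 - p * κ + p ^ 2 * K ^ 2 := by
        rw [integral_add (integrable_const _) (hI.const_mul p), integral_const_mul, hint]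
        simp
        ring

end UniformDrift

/-! ### Effect of one update on the angle -/

section Update

variable {d : ℕ} {η : ℝ} {u w v : EuclideanSpace ℝ (Fin d)}

theorem inner_shiftedOpinion (hv : ‖v‖ = 1) :
    inner ℝ (shiftedOpinion η u v) (shiftedOpinion η w v) =
      inner ℝ u w + (2 * η + η ^ 2) * (inner ℝ u v * inner ℝ w v) := by
  have hvv : inner ℝ v v = 1 := by rw [real_inner_self_eq_norm_sq, hv, one_pow]
  simp only [shiftedOpinion, inner_add_left, inner_add_right, real_inner_smul_left,
    real_inner_smul_right, hvv, real_inner_comm w v]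
  ring

theorem norm_shiftedOpinion_sq (hv : ‖v‖ = 1) (hu : ‖u‖ = 1) :
    ‖shiftedOpinion η u v‖ ^ 2 = 1 + (2 * η + η ^ 2) * inner ℝ u v ^ 2 := by
  rw [← real_inner_self_eq_norm_sq, inner_shiftedOpinion hv, real_inner_self_eq_norm_sq, hu]
  ring

theorem norm_shiftedOpinion_pos (hη : 0 < η) (hv : ‖v‖ = 1) (hu : ‖u‖ = 1) :
    0 < ‖shiftedOpinion η u v‖ := by
  have := norm_shiftedOpinion_sq (η := η) hv hu
  exact (norm_nonneg _).lt_of_ne' fun h => by rw [h] at this; nlinarith [sq_nonneg (inner ℝ u v)]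

theorem norm_updateOpinion (hη : 0 < η) (hv : ‖v‖ = 1) (hu : ‖u‖ = 1) :
    ‖updateOpinion η u v‖ = 1 :=
  norm_smul_inv_norm (𝕜 := ℝ) (norm_pos_iff.1 (norm_shiftedOpinion_pos hη hv hu))

theorem inner_updateOpinion (hv : ‖v‖ = 1) :
    inner ℝ (updateOpinion η u v) (updateOpinion η w v) =
      (‖shiftedOpinion η u v‖ * ‖shiftedOpinion η w v‖)⁻¹ *
        (inner ℝ u w + (2 * η + η ^ 2) * (inner ℝ u v * inner ℝ w v)) := by
  rw [updateOpinion, updateOpinion, real_inner_smul_left, real_inner_smul_right,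
    inner_shiftedOpinion hv, mul_inv, mul_assoc]

/-- The squared sine of the angle between two unit vectors. -/
noncomputable def sqSin (u w : EuclideanSpace ℝ (Fin d)) : ℝ := 1 - inner ℝ u w ^ 2

theorem sqSin_nonneg (hu : ‖u‖ = 1) (hw : ‖w‖ = 1) : 0 ≤ sqSin u w :=
  sub_nonneg.2 (sq_inner_le_one hu hw)

theorem norm_sub_inner_smul_sq (hu : ‖u‖ = 1) (hw : ‖w‖ = 1) :
    ‖w - inner ℝ u w • u‖ ^ 2 = sqSin u w := by
  rw [norm_sub_sq_real, norm_smul, real_inner_smul_right, real_inner_comm u w, hu, hw, mul_one,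
    Real.norm_eq_abs, sq_abs, sqSin]
  ring

/-- The numerator is the Gram determinant of the shifted vectors; its `c²` terms cancel because the
perturbation has rank one. -/
theorem sqSin_updateOpinion (hη : 0 < η) (hv : ‖v‖ = 1) (hu : ‖u‖ = 1) (hw : ‖w‖ = 1) :
    sqSin (updateOpinion η u v) (updateOpinion η w v) =
      ((1 - inner ℝ u w ^ 2) + (2 * η + η ^ 2) * (inner ℝ u v ^ 2 + inner ℝ w v ^ 2 -
        2 * inner ℝ u w * inner ℝ u v * inner ℝ w v)) /
      ((1 + (2 * η + η ^ 2) * inner ℝ u v ^ 2) * (1 + (2 * η + η ^ 2) * inner ℝ w v ^ 2)) := by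
  have h1 := norm_shiftedOpinion_pos hη hv hu
  have h2 := norm_shiftedOpinion_pos hη hv hw
  rw [sqSin, inner_updateOpinion hv, ← norm_shiftedOpinion_sq hv hu, ← norm_shiftedOpinion_sq hv hw]
  field_simp
  rw [norm_shiftedOpinion_sq hv hu, norm_shiftedOpinion_sq hv hw]
  ring

/-- Two unit vectors that are not parallel can be completed, each one separately, to orthonormal
bases of the plane they span. -/
theorem exists_orthonormal_of_sqSin_pos (hu : ‖u‖ = 1) (hw : ‖w‖ = 1) (h : 0 < sqSin u w) :
    ∃ a b : EuclideanSpace ℝ (Fin d), ‖a‖ = 1 ∧ inner ℝ u a = 0 ∧ ‖b‖ = 1 ∧ inner ℝ w b = 0 ∧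
      ∀ v, inner ℝ u v ^ 2 + inner ℝ w v ^ 2 - 2 * inner ℝ u w * inner ℝ u v * inner ℝ w v =
          sqSin u w * (inner ℝ u v ^ 2 + inner ℝ a v ^ 2) ∧
        inner ℝ u v ^ 2 + inner ℝ w v ^ 2 - 2 * inner ℝ u w * inner ℝ u v * inner ℝ w v =
          sqSin u w * (inner ℝ w v ^ 2 + inner ℝ b v ^ 2) := by
  have key : ∀ {x y : EuclideanSpace ℝ (Fin d)}, ‖x‖ = 1 → ‖y‖ = 1 → 0 < sqSin x y →
      ∃ a : EuclideanSpace ℝ (Fin d), ‖a‖ = 1 ∧ inner ℝ x a = 0 ∧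
        ∀ v, inner ℝ x v ^ 2 + inner ℝ y v ^ 2 - 2 * inner ℝ x y * inner ℝ x v * inner ℝ y v =
          sqSin x y * (inner ℝ x v ^ 2 + inner ℝ a v ^ 2) := by
    intro x y hx hy hs
    have hxx : inner ℝ x x = 1 := by rw [real_inner_self_eq_norm_sq, hx, one_pow]
    have hyy : inner ℝ y y = 1 := by rw [real_inner_self_eq_norm_sq, hy, one_pow]
    set r := Real.sqrt (sqSin x y)
    have hr : 0 < r := Real.sqrt_pos.2 hs
    have hr2 : r ^ 2 = sqSin x y := Real.sq_sqrt hs.le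
    refine ⟨r⁻¹ • (y - inner ℝ x y • x), ?_, ?_, fun v => ?_⟩
    · rw [← sq_eq_sq₀ (norm_nonneg _) zero_le_one, one_pow, ← real_inner_self_eq_norm_sq]
      simp only [real_inner_smul_left, real_inner_smul_right, inner_sub_left, inner_sub_right, hxx,
        hyy, real_inner_comm x y]
      field_simp
      rw [hr2, sqSin]
      ring
    · simp [inner_smul_right, inner_sub_right, hx]
    · simp only [real_inner_smul_left, inner_sub_left, mul_pow, mul_add, ← hr2]
      field_simp
      rw [hr2, sqSin]
      ring
  obtain ⟨a, ha, hua, ha'⟩ := key hu hw h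
  obtain ⟨b, hb, hwb, hb'⟩ := key hw hu (by rwa [sqSin, real_inner_comm])
  refine ⟨a, b, ha, hua, hb, hwb, fun v => ⟨ha' v, ?_⟩⟩
  have := hb' v
  rw [sqSin, real_inner_comm u w] at this
  rw [sqSin, ← this]
  ring

/-- The growth factor is the exponential of the mean of the two gains, and AM-GM separates them, so
that each can be integrated on its own. -/
theorem sqSin_updateOpinion_rpow_le (hη : 0 < η) (hu : ‖u‖ = 1) (hw : ‖w‖ = 1)
    {a b : EuclideanSpace ℝ (Fin d)} {p : ℝ} (hs : 0 < sqSin u w) (hv : ‖v‖ = 1)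
    (ha : inner ℝ u v ^ 2 + inner ℝ w v ^ 2 - 2 * inner ℝ u w * inner ℝ u v * inner ℝ w v =
      sqSin u w * (inner ℝ u v ^ 2 + inner ℝ a v ^ 2))
    (hb : inner ℝ u v ^ 2 + inner ℝ w v ^ 2 - 2 * inner ℝ u w * inner ℝ u v * inner ℝ w v =
      sqSin u w * (inner ℝ w v ^ 2 + inner ℝ b v ^ 2)) :
    sqSin (updateOpinion η u v) (updateOpinion η w v) ^ p ≤
      sqSin u w ^ p * ((Real.exp (p * logGain (2 * η + η ^ 2) u a v) +
        Real.exp (p * logGain (2 * η + η ^ 2) w b v)) / 2) := by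
  set c := 2 * η + η ^ 2
  have hc : 0 < c := by positivity
  have hB1 : 0 < 1 + c * inner ℝ u v ^ 2 := by positivity
  have hB2 : 0 < 1 + c * inner ℝ w v ^ 2 := by positivity
  have hA : 0 < 1 + c * (inner ℝ u v ^ 2 + inner ℝ a v ^ 2) := by positivity
  have hab : inner ℝ u v ^ 2 + inner ℝ a v ^ 2 = inner ℝ w v ^ 2 + inner ℝ b v ^ 2 :=
    mul_left_cancel₀ hs.ne' (ha.symm.trans hb)
  have heq : sqSin (updateOpinion η u v) (updateOpinion η w v) = sqSin u w *
      Real.exp ((logGain c u a v + logGain c w b v) / 2) := by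
    have : (logGain c u a v + logGain c w b v) / 2 =
        Real.log ((1 + c * (inner ℝ u v ^ 2 + inner ℝ a v ^ 2)) /
          ((1 + c * inner ℝ u v ^ 2) * (1 + c * inner ℝ w v ^ 2))) := by
      rw [Real.log_div hA.ne' (by positivity), Real.log_mul hB1.ne' hB2.ne', logGain, logGain, ← hab]
      ring
    rw [this, Real.exp_log (by positivity), sqSin_updateOpinion hη hv hu hw, ha, sqSin]
    ring
  rw [heq, Real.mul_rpow hs.le (Real.exp_pos _).le]
  refine mul_le_mul_of_nonneg_left ?_ (Real.rpow_nonneg hs.le _)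
  rw [← Real.exp_mul]
  have e1 : Real.exp (p * logGain c u a v) = Real.exp (p * logGain c u a v / 2) ^ 2 := by
    rw [← Real.exp_nat_mul]; congr 1; push_cast; ring
  have e2 : Real.exp (p * logGain c w b v) = Real.exp (p * logGain c w b v / 2) ^ 2 := by
    rw [← Real.exp_nat_mul]; congr 1; push_cast; ring
  have e3 : Real.exp ((logGain c u a v + logGain c w b v) / 2 * p) =
      Real.exp (p * logGain c u a v / 2) * Real.exp (p * logGain c w b v / 2) := by
    rw [← Real.exp_add]; congr 1; ring
  rw [e1, e2, e3]
  nlinarith [sq_nonneg (Real.exp (p * logGain c u a v / 2) - Real.exp (p * logGain c w b v / 2))]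

/-- Here `w = ±u`, a line that the update preserves. This degenerate case needs its own argument
because there is no plane in which to complete the vectors. -/
theorem sqSin_updateOpinion_eq_zero (hη : 0 < η) (hv : ‖v‖ = 1) (hu : ‖u‖ = 1) (hw : ‖w‖ = 1)
    (hs : sqSin u w = 0) : sqSin (updateOpinion η u v) (updateOpinion η w v) = 0 := by
  have hx : inner ℝ u w ^ 2 = 1 := (sub_eq_zero.1 hs).symm
  have hz : w - inner ℝ u w • u = 0 := by
    rw [← norm_eq_zero, ← sq_eq_zero_iff, norm_sub_inner_smul_sq hu hw, hs]
  have hwv : inner ℝ w v = inner ℝ u w * inner ℝ u v := by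
    rw [← real_inner_smul_left, ← sub_eq_zero, ← inner_sub_left, hz, inner_zero_left]
  rw [sqSin_updateOpinion hη hv hu hw, hwv]
  rw [show (1 - inner ℝ u w ^ 2) + (2 * η + η ^ 2) * (inner ℝ u v ^ 2 +
      (inner ℝ u w * inner ℝ u v) ^ 2 - 2 * inner ℝ u w * inner ℝ u v *
      (inner ℝ u w * inner ℝ u v)) = (1 - inner ℝ u w ^ 2) *
      (1 + (2 * η + η ^ 2) * inner ℝ u v ^ 2) by ring, hx]
  simp

/-- Once the angle to the line is small, an update cannot flip the relative sign. -/
theorem inner_mul_inner_updateOpinion_pos (hη : 0 < η) (hv : ‖v‖ = 1) (hu : ‖u‖ = 1)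
    (hw : ‖w‖ = 1) (hs : (2 * η + η ^ 2) ^ 2 * sqSin u w < inner ℝ u w ^ 2) :
    0 < inner ℝ u w * inner ℝ (updateOpinion η u v) (updateOpinion η w v) := by
  have h1 := norm_shiftedOpinion_pos hη hv hu
  have h2 := norm_shiftedOpinion_pos hη hv hw
  set c := 2 * η + η ^ 2
  have hc : 0 < c := by positivity
  set x := inner ℝ u w with hx
  set α := inner ℝ u v with hα
  set γ := inner ℝ w v with hγ
  have hα1 : α ^ 2 ≤ 1 := sq_inner_le_one hu hv
  -- The quantity `γ - xα` is the component along `v` of the part of `w` orthogonal to `u`. The new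
  -- inner product has the sign of `x + cαγ = x + cxα² + cα(γ - xα)`, whose last term is smaller
  -- than `x` in absolute value.
  have hδ : (γ - x * α) ^ 2 ≤ sqSin u w := by
    have h3 : inner ℝ (w - x • u) v = γ - x * α := by
      rw [inner_sub_left, real_inner_smul_left]
    have h4 : ‖w - x • u‖ ^ 2 = sqSin u w := norm_sub_inner_smul_sq hu hw
    rw [← h3, ← h4]
    refine sq_le_sq' ?_ ?_
    · have := neg_le_of_abs_le (abs_real_inner_le_norm (w - x • u) v)
      rwa [hv, mul_one] at this
    · have := le_of_abs_le (abs_real_inner_le_norm (w - x • u) v)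
      rwa [hv, mul_one] at this
  have habs : |c * α * (γ - x * α)| < |x| := by
    rw [← sq_lt_sq]
    calc (c * α * (γ - x * α)) ^ 2 = c ^ 2 * (α ^ 2 * (γ - x * α) ^ 2) := by ring
      _ ≤ c ^ 2 * (1 * sqSin u w) := by gcongr
      _ < x ^ 2 := by rwa [one_mul]
  have hx0 : 0 < |x| := (abs_nonneg _).trans_lt habs
  rw [inner_updateOpinion hv, mul_left_comm]
  refine mul_pos (by positivity) ?_
  have h5 : |x * (c * α * (γ - x * α))| < x ^ 2 := by
    rw [abs_mul, ← sq_abs x, sq]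
    exact mul_lt_mul_of_pos_left habs hx0
  have h6 := (abs_lt.1 h5).1
  have h7 : 0 ≤ c * (x * α) ^ 2 := by positivity
  linear_combination h6 + h7

end Update

theorem Measurable.updateOpinion {α : Type*} [MeasurableSpace α] {d : ℕ} (η : ℝ)
    {f g : α → EuclideanSpace ℝ (Fin d)} (hf : Measurable f) (hg : Measurable g) :
    Measurable fun x => updateOpinion η (f x) (g x) := by
  have h : Measurable fun x => shiftedOpinion η (f x) (g x) := by
    unfold shiftedOpinion
    fun_prop
  exact h.norm.inv.smul h

theorem Measurable.sqSin {α : Type*} [MeasurableSpace α] {d : ℕ}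
    {f g : α → EuclideanSpace ℝ (Fin d)} (hf : Measurable f) (hg : Measurable g) :
    Measurable fun x => sqSin (f x) (g x) :=
  ((hf.inner hg).pow_const 2).const_sub 1

/-! ### Contraction in expectation -/

section Contraction

variable {d : ℕ} {η : ℝ}

/-- One update contracts a small moment of the squared sine, uniformly over all pairs. -/
theorem exists_lintegral_sqSin_updateOpinion_le [IsProbabilityMeasure (uniformSphereAmbient d)]
    (hd : 2 ≤ d) (hη : 0 < η) :
    ∃ p > (0 : ℝ), ∃ ρ : ENNReal, ρ < 1 ∧
      ∀ u w : EuclideanSpace ℝ (Fin d), ‖u‖ = 1 → ‖w‖ = 1 →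
        ∫⁻ v, ENNReal.ofReal (sqSin (updateOpinion η u v) (updateOpinion η w v) ^ p)
          ∂uniformSphereAmbient d ≤ ρ * ENNReal.ofReal (sqSin u w ^ p) := by
  have hc : 0 < 2 * η + η ^ 2 := by positivity
  obtain ⟨p, hp, ρ, hρ, h⟩ := exists_integral_exp_logGain_le hd hc
  refine ⟨p, hp, ENNReal.ofReal ρ, ENNReal.ofReal_lt_one.2 hρ, fun u w hu hw => ?_⟩
  have hae := ae_norm_eq_one_uniformSphereAmbient d
  rcases (sqSin_nonneg hu hw).eq_or_lt' with hs | hs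
  · rw [lintegral_congr_ae (g := 0), Pi.zero_def, lintegral_zero]
    · exact zero_le
    · filter_upwards [hae] with v hv
      rw [sqSin_updateOpinion_eq_zero hη hv hu hw hs, Real.zero_rpow hp.ne', ENNReal.ofReal_zero]
      rfl
  obtain ⟨a, b, ha, hua, hb, hwb, hab⟩ := exists_orthonormal_of_sqSin_pos hu hw hs
  have hI {x y : EuclideanSpace ℝ (Fin d)} (hx : ‖x‖ = 1) (hy : ‖y‖ = 1) :
      Integrable (fun v => Real.exp (p * logGain (2 * η + η ^ 2) x y v))
        (uniformSphereAmbient d) := by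
    refine Integrable.of_bound
      ((measurable_logGain _ x y).const_mul p).exp.aestronglyMeasurable
      (Real.exp (p * (2 * Real.log (1 + 2 * (2 * η + η ^ 2))))) ?_
    filter_upwards [hae] with v hv
    rw [Real.norm_of_nonneg (Real.exp_pos _).le]
    exact Real.exp_le_exp.2 (mul_le_mul_of_nonneg_left
      ((le_abs_self _).trans (abs_logGain_le hc hx hy hv)) hp.le)
  have hint := ((hI hu ha).add (hI hw hb)).div_const 2 |>.const_mul (sqSin u w ^ p)
  calc _ ≤ ∫⁻ v, ENNReal.ofReal (sqSin u w ^ p *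
        ((Real.exp (p * logGain (2 * η + η ^ 2) u a v) +
          Real.exp (p * logGain (2 * η + η ^ 2) w b v)) / 2)) ∂uniformSphereAmbient d := by
        refine lintegral_mono_ae ?_
        filter_upwards [hae] with v hv
        exact ENNReal.ofReal_le_ofReal
          (sqSin_updateOpinion_rpow_le hη hu hw hs hv (hab v).1 (hab v).2)
    _ = ENNReal.ofReal (∫ v, sqSin u w ^ p *
        ((Real.exp (p * logGain (2 * η + η ^ 2) u a v) +
          Real.exp (p * logGain (2 * η + η ^ 2) w b v)) / 2) ∂uniformSphereAmbient d) :=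
        (ofReal_integral_eq_lintegral_ofReal hint (ae_of_all _ fun v =>
          mul_nonneg (Real.rpow_nonneg hs.le _)
            (div_nonneg (add_nonneg (Real.exp_pos _).le (Real.exp_pos _).le) zero_le_two))).symm
    _ ≤ ENNReal.ofReal (ρ * sqSin u w ^ p) := by
        refine ENNReal.ofReal_le_ofReal ?_
        rw [integral_const_mul, integral_div, integral_add (hI hu ha) (hI hw hb), mul_comm]
        refine mul_le_mul_of_nonneg_right ?_ (Real.rpow_nonneg hs.le _)
        linarith [h u a hu ha hua, h w b hw hb hwb]
    _ = _ := ENNReal.ofReal_mul' (Real.rpow_nonneg hs.le _)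

end Contraction

/-! ### Deterministic trajectories and the frozen sign -/

section Opinion

variable {d : ℕ} {η : ℝ} {u w : EuclideanSpace ℝ (Fin d)}

theorem opinion_congr {v v' : ℕ → EuclideanSpace ℝ (Fin d)} {t : ℕ}
    (h : ∀ s < t, v s = v' s) : opinion η u v t = opinion η u v' t := by
  induction t with
  | zero => rfl
  | succ t ih => rw [opinion, opinion, ih fun s hs => h s (by omega), h t t.lt_succ_self]

theorem norm_opinion (hη : 0 < η) (hu : ‖u‖ = 1) {v : ℕ → EuclideanSpace ℝ (Fin d)}
    (hv : ∀ t, ‖v t‖ = 1) (t : ℕ) : ‖opinion η u v t‖ = 1 := by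
  induction t with
  | zero => exact hu
  | succ t ih => exact norm_updateOpinion hη (hv t) ih

theorem measurable_opinion (t : ℕ) :
    Measurable fun v : ℕ → EuclideanSpace ℝ (Fin d) => opinion η u v t := by
  induction t with
  | zero => exact measurable_const
  | succ t ih => exact ih.updateOpinion η (measurable_pi_apply t)

/-- If two trajectories become parallel in the limit, they converge up to a fixed sign. -/
theorem tendsto_sub_or_add_of_sqSin (hη : 0 < η) (hu : ‖u‖ = 1) (hw : ‖w‖ = 1)
    {v : ℕ → EuclideanSpace ℝ (Fin d)} (hv : ∀ t, ‖v t‖ = 1)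
    (h : Tendsto (fun t => sqSin (opinion η u v t) (opinion η w v t)) atTop (𝓝 0)) :
    Tendsto (fun t => ‖opinion η u v t - opinion η w v t‖) atTop (𝓝 0) ∨
      Tendsto (fun t => ‖opinion η u v t + opinion η w v t‖) atTop (𝓝 0) := by
  set x : ℕ → ℝ := fun t => inner ℝ (opinion η u v t) (opinion η w v t) with hx
  have hU := norm_opinion hη hu hv
  have hW := norm_opinion hη hw hv
  have hx2 : Tendsto (fun t => x t ^ 2) atTop (𝓝 1) := by
    simpa [sqSin, hx] using h.const_sub 1
  have hstep : ∀ᶠ t in atTop, 0 < x t * x (t + 1) := by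
    have := (h.const_mul ((2 * η + η ^ 2) ^ 2))
    rw [mul_zero] at this
    filter_upwards [this.eventually_lt hx2 one_pos] with t ht
    exact inner_mul_inner_updateOpinion_pos hη (hv t) (hU t) (hW t) ht
  obtain ⟨T, hT⟩ := eventually_atTop.1 hstep
  have habs : Tendsto (fun t => |x t|) atTop (𝓝 1) := by
    simpa [Real.sqrt_sq_eq_abs] using hx2.sqrt
  rcases (left_ne_zero_of_mul (hT T le_rfl).ne').lt_or_gt with h0 | h0
  · right
    have hneg : ∀ t ≥ T, x t < 0 := fun t ht => by
      induction t, ht using Nat.le_induction with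
      | base => exact h0
      | succ t ht ih => exact (neg_iff_neg_of_mul_pos (hT t ht)).1 ih
    have hx1 : Tendsto x atTop (𝓝 (-1)) := by
      refine habs.neg.congr' ?_
      filter_upwards [eventually_ge_atTop T] with t ht
      rw [abs_of_neg (hneg t ht), neg_neg]
    have : Tendsto (fun t => Real.sqrt (2 + 2 * x t)) atTop (𝓝 0) := by
      simpa using ((hx1.const_mul 2).const_add 2).sqrt
    refine this.congr fun t => ?_
    rw [← Real.sqrt_sq (norm_nonneg (opinion η u v t + opinion η w v t)), norm_add_sq_real, hU, hW]
    congr 1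
    ring
  · left
    have hpos : ∀ t ≥ T, 0 < x t := fun t ht => by
      induction t, ht using Nat.le_induction with
      | base => exact h0
      | succ t ht ih => exact (pos_iff_pos_of_mul_pos (hT t ht)).1 ih
    have hx1 : Tendsto x atTop (𝓝 1) := by
      refine habs.congr' ?_
      filter_upwards [eventually_ge_atTop T] with t ht
      rw [abs_of_pos (hpos t ht)]
    have : Tendsto (fun t => Real.sqrt (2 - 2 * x t)) atTop (𝓝 0) := by
      simpa using ((hx1.const_mul 2).const_sub 2).sqrt
    refine this.congr fun t => ?_
    rw [← Real.sqrt_sq (norm_nonneg (opinion η u v t - opinion η w v t)), norm_sub_sq_real, hU, hW]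
    congr 1
    ring

end Opinion

/-! ### Random trajectories and almost sure convergence -/

section Trajectories

variable {Ω : Type*} [MeasurableSpace Ω] {P : Measure Ω} {d : ℕ} {η : ℝ}
  {V : ℕ → Ω → EuclideanSpace ℝ (Fin d)} {u w : EuclideanSpace ℝ (Fin d)}

/-- The current pair of opinions is independent of the next intervention. -/
theorem indepFun_opinion (hV : ∀ t, AEMeasurable (V t) P) (hind : iIndepFun V P) (t : ℕ) :
    IndepFun (fun ω => (opinion η u (fun s => V s ω) t, opinion η w (fun s => V s ω) t)) (V t) P := by
  have h := hind.indepFun_finset₀ (Finset.range t) {t} (by simp) hV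
  -- The opinion at time `t` depends only on interventions before `t`, so a finite history can be
  -- padded with zeros.
  let ext (z : Finset.range t → EuclideanSpace ℝ (Fin d)) (s : ℕ) : EuclideanSpace ℝ (Fin d) :=
    if hs : s ∈ Finset.range t then z ⟨s, hs⟩ else 0
  have hext : Measurable ext := by
    refine measurable_pi_lambda _ fun s => ?_
    by_cases hs : s ∈ Finset.range t
    · simpa only [ext, hs, dite_true] using measurable_pi_apply _
    · simpa only [ext, hs, dite_false] using measurable_const
  have h' := h.comp
    (((measurable_opinion (η := η) (u := u) t).comp hext).prodMk
      ((measurable_opinion (η := η) (u := w) t).comp hext))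
    (measurable_pi_apply (⟨t, Finset.mem_singleton_self t⟩ : ({t} : Finset ℕ)))
  have heq (x : EuclideanSpace ℝ (Fin d)) (ω : Ω) :
      opinion η x (ext fun i => V i ω) t = opinion η x (fun s => V s ω) t :=
    opinion_congr fun s hs => by simp [ext, hs]
  convert! h' using 1
  ext1 ω
  simp [heq]

/-- Independence makes the joint law a product, so Tonelli allows integrating over the intervention
first, with the current pair frozen. -/
theorem lintegral_sqSin_updateOpinion_le [IsProbabilityMeasure P]
    [IsProbabilityMeasure (uniformSphereAmbient d)]
    {p : ℝ} {ρ : ENNReal} {X Y W : Ω → EuclideanSpace ℝ (Fin d)} (hX : AEMeasurable X P)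
    (hY : AEMeasurable Y P) (hW : HasLaw W (uniformSphereAmbient d) P)
    (hind : IndepFun (fun ω => (X ω, Y ω)) W P)
    (hcontr : ∀ ω, ∫⁻ v, ENNReal.ofReal (sqSin (updateOpinion η (X ω) v)
      (updateOpinion η (Y ω) v) ^ p) ∂uniformSphereAmbient d ≤
        ρ * ENNReal.ofReal (sqSin (X ω) (Y ω) ^ p)) :
    ∫⁻ ω, ENNReal.ofReal (sqSin (updateOpinion η (X ω) (W ω)) (updateOpinion η (Y ω) (W ω)) ^ p) ∂P
      ≤ ρ * ∫⁻ ω, ENNReal.ofReal (sqSin (X ω) (Y ω) ^ p) ∂P := by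
  have hXY := hX.prodMk hY
  have hF : Measurable fun z : (EuclideanSpace ℝ (Fin d) × EuclideanSpace ℝ (Fin d)) ×
      EuclideanSpace ℝ (Fin d) => ENNReal.ofReal (sqSin (updateOpinion η z.1.1 z.2)
        (updateOpinion η z.1.2 z.2) ^ p) :=
    (((measurable_fst.fst.updateOpinion η measurable_snd).sqSin
      (measurable_fst.snd.updateOpinion η measurable_snd)).pow_const p).ennreal_ofReal
  have hD : AEMeasurable (fun ω => ENNReal.ofReal (sqSin (X ω) (Y ω) ^ p)) P :=
    (((hX.inner hY).pow_const 2).const_sub 1 |>.pow_const p).ennreal_ofReal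
  have hpair := (indepFun_iff_map_prod_eq_prod_map_map hXY hW.aemeasurable).1 hind
  rw [hW.map_eq] at hpair
  have h1 := lintegral_map' hF.aemeasurable (hXY.prodMk hW.aemeasurable)
  rw [hpair, lintegral_prod _ hF.aemeasurable,
    lintegral_map' hF.lintegral_prod_right'.aemeasurable hXY] at h1
  exact h1.symm.le.trans ((lintegral_mono hcontr).trans_eq
    (lintegral_const_mul'' ρ hD))

theorem ae_tendsto_sqSin_opinion [IsProbabilityMeasure P] (hd : 2 ≤ d) (hη : 0 < η) (hu : ‖u‖ = 1)
    (hw : ‖w‖ = 1) (hlaw : ∀ t, HasLaw (V t) (uniformSphereAmbient d) P) (hind : iIndepFun V P)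
    (hnorm : ∀ t ω, ‖V t ω‖ = 1) :
    ∀ᵐ ω ∂P, Tendsto (fun t => sqSin (opinion η u (fun s => V s ω) t)
      (opinion η w (fun s => V s ω) t)) atTop (𝓝 0) := by
  have hV t : AEMeasurable (V t) P := (hlaw t).aemeasurable
  have : IsProbabilityMeasure (uniformSphereAmbient d) := by
    rw [← (hlaw 0).map_eq]
    exact Measure.isProbabilityMeasure_map (hV 0)
  obtain ⟨p, hp, ρ, hρ, hcontr⟩ := exists_lintegral_sqSin_updateOpinion_le hd hη
  have hX (x : EuclideanSpace ℝ (Fin d)) t : AEMeasurable (fun ω => opinion η x (V · ω) t) P :=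
    (measurable_opinion t).comp_aemeasurable (aemeasurable_pi_lambda _ hV)
  have hU t ω := norm_opinion hη hu (hnorm · ω) t
  have hW t ω := norm_opinion hη hw (hnorm · ω) t
  set D : ℕ → Ω → ENNReal := fun t ω =>
    ENNReal.ofReal (sqSin (opinion η u (V · ω) t) (opinion η w (V · ω) t) ^ p) with hDdef
  have hD t : AEMeasurable (D t) P :=
    ((((hX u t).inner (hX w t)).pow_const 2).const_sub 1 |>.pow_const p).ennreal_ofReal
  have hstep t : ∫⁻ ω, D (t + 1) ω ∂P ≤ ρ * ∫⁻ ω, D t ω ∂P :=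
    lintegral_sqSin_updateOpinion_le (hX u t) (hX w t) (hlaw t) (indepFun_opinion hV hind t)
      fun ω => hcontr _ _ (hU t ω) (hW t ω)
  have hgeom t : ∫⁻ ω, D t ω ∂P ≤ ρ ^ t * ENNReal.ofReal (sqSin u w ^ p) := by
    induction t with
    | zero => simp [D, opinion]
    | succ t ih => exact (hstep t).trans (by rw [pow_succ', mul_assoc]; gcongr)
  -- A finite expected sum makes the series converge almost surely, so its terms tend to zero;
  -- taking `p`-th roots then gives the squared sine itself.
  have hsum : ∫⁻ ω, ∑' t, D t ω ∂P ≠ ⊤ := by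
    rw [lintegral_tsum hD]
    refine ne_top_of_le_ne_top ?_ (ENNReal.tsum_le_tsum hgeom)
    rw [ENNReal.tsum_mul_right, ENNReal.tsum_geometric]
    exact ENNReal.mul_ne_top (ENNReal.inv_ne_top.2 (tsub_pos_of_lt hρ).ne') ENNReal.ofReal_ne_top
  filter_upwards [ae_lt_top' (AEMeasurable.tsum hD) hsum] with ω hω
  have h0 := (ENNReal.tendsto_toReal ENNReal.zero_ne_top).comp
    (ENNReal.tendsto_atTop_zero_of_tsum_ne_top hω.ne)
  have h1 := h0.rpow_const (p := p⁻¹) (Or.inr (by positivity))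
  rw [ENNReal.toReal_zero, Real.zero_rpow (inv_ne_zero hp.ne')] at h1
  refine h1.congr fun t => ?_
  have hs := sqSin_nonneg (hU t ω) (hW t ω)
  rw [Function.comp_apply, hDdef, ENNReal.toReal_ofReal (Real.rpow_nonneg hs p),
    Real.rpow_rpow_inv hs hp.ne']

end Trajectories

theorem theorem1 {Ω : Type*} [MeasurableSpace Ω] (P : Measure Ω) [IsProbabilityMeasure P]
    (d : ℕ) (hd : 2 ≤ d) (η : ℝ) (hη : 0 < η)
    (n : ℕ) (u : Fin n → Metric.sphere (0 : EuclideanSpace ℝ (Fin d)) 1)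
    (v : ℕ → Ω → Metric.sphere (0 : EuclideanSpace ℝ (Fin d)) 1)
    (hv_law : ∀ t, HasLaw (v t) (uniformSphere d) P) (hv_indep : iIndepFun v P)
    (i j : Fin n) (hij : i < j) :
    ∀ᵐ ω ∂P,
      Tendsto (fun t => ‖opinion η (u i : EuclideanSpace ℝ (Fin d)) (fun s => (v s ω : EuclideanSpace ℝ (Fin d))) t -
          opinion η (u j : EuclideanSpace ℝ (Fin d)) (fun s => (v s ω : EuclideanSpace ℝ (Fin d))) t‖) atTop (𝓝 0) ∨
      Tendsto (fun t => ‖opinion η (u i : EuclideanSpace ℝ (Fin d)) (fun s => (v s ω : EuclideanSpace ℝ (Fin d))) t +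
          opinion η (u j : EuclideanSpace ℝ (Fin d)) (fun s => (v s ω : EuclideanSpace ℝ (Fin d))) t‖) atTop (𝓝 0) := by
  have hlaw t : HasLaw (fun ω => (v t ω : EuclideanSpace ℝ (Fin d))) (uniformSphereAmbient d) P :=
    ⟨measurable_subtype_coe.comp_aemeasurable (hv_law t).aemeasurable, by
      rw [uniformSphereAmbient, ← (hv_law t).map_eq, AEMeasurable.map_map_of_aemeasurable
        measurable_subtype_coe.aemeasurable (hv_law t).aemeasurable]
      rfl⟩
  have hind : iIndepFun (fun t ω => (v t ω : EuclideanSpace ℝ (Fin d))) P :=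
    hv_indep.comp (fun _ => Subtype.val) fun _ => measurable_subtype_coe
  filter_upwards [ae_tendsto_sqSin_opinion hd hη (norm_eq_of_mem_sphere (u i))
    (norm_eq_of_mem_sphere (u j)) hlaw hind fun t ω => norm_eq_of_mem_sphere (v t ω)] with ω hω
  exact tendsto_sub_or_add_of_sqSin hη (norm_eq_of_mem_sphere (u i)) (norm_eq_of_mem_sphere (u j))
    (fun t => norm_eq_of_mem_sphere (v t ω)) hω
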